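/- Let $T$ be a $k$-regular tree and let $\phi : VT \to \mathcal A$ be a coloring of its vertices. For a set $K$ of vertices, regarded as the induced subgraph with the restricted coloring, write $[K]=[K']$ if there is a color-preserving graph isomorphism from $K$ to $K'$. Let $B_n(x)$ be the ball of radius $n$ around the vertex $x$, and let $b_\phi(n)$ be the number of distinct classes $[B_n(x)]$, $x\in VT$. The coloring $\phi$ is *Sturmian* if $b_\phi(n)=n+2$ for all $n\ge 0$. A coloring $\psi$ of $VT$ is *periodic* if it is invariant under a group $\Gamma$ of automorphisms of $T$ such that $\Gamma\backslash T$ is a finite graph. The coloring $\phi$ is *eventually periodic* if there is a finite (nonempty) subtree $K$ of $T$ such that, for each connected component $T_j$ of $T-K$, there is a periodic coloring $\phi_j$ of $T$ with $\phi_j|_{T_j}=\phi|_{T_j}$. Let $\phi$ be Sturmian. Then $\phi$ is eventually periodic if and only if there exists a finite (nonempty) colored subtree which appears exactly once, i.e. a finite subtree $K$ of $T$ such that $[K']=[K]$ implies $K'=K$. Moreover, if such a subtree exists, then there is a finite subtree $K$ of $T$ such that, for each connected component $T_j$ of $T-K$, there is a periodic coloring $\phi_j$ of $T$ with $\phi_j|_{T_j}=\phi|_{T_j}$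 which is the lift of a coloring of a finite edge-indexed graph whose universal covering tree is $T$. Here a finite edge-indexed graph $(X,i)$ is a finite graph $X$, possibly with loops, with an index $i(e)\ge 1$ on each oriented edge $e$ (the indices of $e$ and of its reverse may differ); $T$ is its universal covering tree, via a projection $\pi : VT\to VX$, if $\pi$ is surjective and, for all $v\in VT$ and $y\in VX$, the number of neighbors of $v$ lying over $y$ is the index of the edge from $\pi(v)$ to $y$ (and $0$ if there is no such edge); and the lift of a coloring $c$ of $VX$ is $c\circ\pi$. -/

import Mathlib

/-- The ball of radius `n` around the vertex `x`, as a set of vertices; the corresponding subgraph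
is the induced one. -/
def nBall {V : Type*} (G : SimpleGraph V) (n : ℕ) (x : V) : Set V :=
  {y | G.dist x y ≤ n}

/-- `[K] = [K']`: there is a color-preserving graph isomorphism between the induced subgraphs on
the vertex sets `K` and `K'`. -/
def ColorEquiv {V A : Type*} (G : SimpleGraph V) (φ : V → A) (K K' : Set V) : Prop :=
  ∃ f : G.induce K ≃g G.induce K', ∀ v : K, φ (f v) = φ v

theorem ColorEquiv.refl {V A : Type*} (G : SimpleGraph V) (φ : V → A) (K : Set V) :
    ColorEquiv G φ K K :=
  ⟨RelIso.refl _, fun _ => rfl⟩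

theorem ColorEquiv.symm {V A : Type*} {G : SimpleGraph V} {φ : V → A} {K K' : Set V}
    (h : ColorEquiv G φ K K') : ColorEquiv G φ K' K := by
  obtain ⟨f, hf⟩ := h
  refine ⟨f.symm, fun v => ?_⟩
  have := hf (f.symm v)
  rw [RelIso.apply_symm_apply] at this
  exact this.symm

theorem ColorEquiv.trans {V A : Type*} {G : SimpleGraph V} {φ : V → A} {K K' K'' : Set V}
    (h : ColorEquiv G φ K K') (h' : ColorEquiv G φ K' K'') : ColorEquiv G φ K K'' := by
  obtain ⟨f, hf⟩ := h
  obtain ⟨g, hg⟩ := h'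
  exact ⟨f.trans g, fun v => (hg (f v)).trans (hf v)⟩

/-- Two vertices are related when the colored `n`-balls around them are equivalent. -/
def ballSetoid {V A : Type*} (G : SimpleGraph V) (φ : V → A) (n : ℕ) : Setoid V where
  r x y := ColorEquiv G φ (nBall G n x) (nBall G n y)
  iseqv := ⟨fun _ => ColorEquiv.refl _ _ _, fun h => h.symm, fun h h' => h.trans h'⟩

/-- The set of colored `n`-balls (equivalence classes of `n`-balls) that appear in the tree. -/
def ColoredBall {V A : Type*} (G : SimpleGraph V) (φ : V → A) (n : ℕ) : Type _ :=
  Quotient (ballSetoid G φ n)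

/-- The subword complexity `b_φ(n)`, the number of colored `n`-balls, as an extended natural
number. -/
noncomputable def subwordComplexity {V A : Type*} (G : SimpleGraph V) (φ : V → A) (n : ℕ) : ℕ∞ :=
  ENat.card (ColoredBall G φ n)

/-- A coloring is Sturmian if `b_φ(n) = n + 2` for every `n ≥ 0`. -/
def IsSturmian {V A : Type*} (G : SimpleGraph V) (φ : V → A) : Prop :=
  ∀ n : ℕ, subwordComplexity G φ n = (n : ℕ∞) + 2

/-- A coloring is periodic if it is invariant under a group `Γ` of automorphisms with finite
quotient graph. For a locally finite graph, the quotient graph is finite as soon as its vertex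
set (the set of `Γ`-orbits of vertices) is finite. -/
def IsPeriodicColoring {V A : Type*} (G : SimpleGraph V) (φ : V → A) : Prop :=
  ∃ Γ : Subgroup (G ≃g G),
    Finite (MulAction.orbitRel.Quotient Γ V) ∧ ∀ γ ∈ Γ, ∀ x : V, φ (γ x) = φ x

/-- `K` is the vertex set of a (nonempty) subtree with finitely many vertices. A connected
subgraph of a tree is a tree and is the induced subgraph on its vertex set. -/
def IsFiniteSubtree {V : Type*} (G : SimpleGraph V) (K : Set V) : Prop :=
  K.Finite ∧ (G.induce K).Connected

/-- A coloring is eventually periodic if, for some finite subtree `K`, the restriction of `φ` to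
each connected component `C` of the complement of `K` extends to a periodic coloring of the whole
tree. (When the tree is locally finite, there are finitely many components.) -/
def IsEventuallyPeriodic {V A : Type*} (G : SimpleGraph V) (φ : V → A) : Prop :=
  ∃ K : Set V, IsFiniteSubtree G K ∧
    ∀ C : G.ComponentCompl K, ∃ ψ : V → A, IsPeriodicColoring G ψ ∧ Set.EqOn ψ φ C

/-- The colored subtree `K` appears exactly once in the colored tree: `K` is the only vertex set
carrying a subtree equivalent to it. -/
def AppearsExactlyOnce {V A : Type*} (G : SimpleGraph V) (φ : V → A) (K : Set V) : Prop :=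
  ∀ K' : Set V, ColorEquiv G φ K K' → K' = K

/-- An edge-indexed graph with vertex set `X`, possibly with loops: there is an oriented edge from
`x` to `y` exactly when `0 < index x y`, and then `index x y` is the index of that edge. The set of
oriented edges is closed under reversal; an edge and its reverse may have different indices. -/
structure EdgeIndexedGraph (X : Type*) where
  index : X → X → ℕ
  index_pos_symm : ∀ x y, 0 < index x y → 0 < index y x

/-- `π` is a covering of the edge-indexed graph `X` by `G`: it is onto, and for every vertex `v`
and every vertex `y` of `X`, exactly `index (π v) y` neighbors of `v` lie over `y`. When `G` is a
tree, this says that `G`, with the projection `π`, is the universal covering tree of `X`. -/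
def EdgeIndexedGraph.IsCovering {V X : Type*} (G : SimpleGraph V) (I : EdgeIndexedGraph X)
    (π : V → X) : Prop :=
  Function.Surjective π ∧
    ∀ (v : V) (y : X), {w | G.Adj v w ∧ π w = y}.encard = (I.index (π v) y : ℕ∞)

/-- The coloring `ψ` of `G` is the lift of a coloring of a finite edge-indexed graph that is
covered by `G`. -/
def IsLiftFromFinite {V A : Type*} (G : SimpleGraph V) (ψ : V → A) : Prop :=
  ∃ (N : ℕ) (I : EdgeIndexedGraph (Fin N)) (π : V → Fin N) (c : Fin N → A),
    I.IsCovering G π ∧ ψ = c ∘ π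

/-! Call a class of colored `n`-balls finite if it occurs around only finitely many vertices. Both
implications pass through the existence of a finite class for some `n`.

This is equivalent to having a subtree that appears once. If `K` appears once, a ball containing `K`
and centered in `K` can recur only around vertices of `K`. Conversely, the union of large balls
around all centers of a finite class appears once.

If `φ` is eventually periodic and no class is finite, then every `n`-ball recurs far from `K`. Its
class is then determined by a component and an orbit of a cocompact group, so `b_φ` is bounded,
contradicting `b_φ(n) = n + 2`.

For the converse, passing from `n` to `n + 1` adds exactly one class, so exactly one `n`-class
splits, in two. Let `F_n` be the set of centers of finite `n`-classes. If it is nonempty, an edge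
leaves it, and the outer endpoint has an infinite `n`-class but a finite `(n + 1)`-class. This
accounts for the single split, so outside the finite set `F_{n+1}` the `n`-class determines the `(n
+ 1)`-class (`ballSetoid_succ_of_notMem`), hence the number of neighbors in each `n`-class. These
numbers index a finite graph whose vertices are `n`-classes. On a component avoiding `F_{n+1}` the
labelling by `n`-classes extends to a covering by the whole tree
(`IsTree.exists_labelling_extension`), and lifts through coverings are periodic
(`IsLiftFromFinite.isPeriodicColoring`). -/

namespace SimpleGraph

/-! ### Distances and parents in a tree -/

variable {V : Type*} {G : SimpleGraph V}

theorem IsTree.length_eq_dist_of_isPath (hT : G.IsTree) {u v : V} {p : G.Walk u v}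
    (hp : p.IsPath) : p.length = G.dist u v := by
  obtain ⟨q, hq, hl⟩ := hT.connected.exists_path_of_dist u v
  rw [(hT.existsUnique_path u v).unique hp hq, hl]

/-- Paths in a tree are unique, so a path inside `S` is already the geodesic of `G`. -/
theorem IsTree.dist_induce (hT : G.IsTree) {S : Set V} {a b : S}
    (h : (G.induce S).Reachable a b) : (G.induce S).dist a b = G.dist (a : V) b := by
  obtain ⟨q, hq, hl⟩ := h.exists_path_of_dist
  have := hT.length_eq_dist_of_isPath
    (hq.map (f := (Embedding.induce S).toHom) Subtype.val_injective)
  rw [Walk.length_map, hl] at this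
  exact this

theorem Reachable.exists_adj_dist_eq {r v : V} (h : G.Reachable r v) (hne : r ≠ v) :
    ∃ u, G.Adj v u ∧ G.Reachable r u ∧ G.dist r v = G.dist r u + 1 := by
  obtain ⟨p, hp⟩ := h.symm.exists_walk_length_eq_dist
  cases p with
  | nil => exact absurd rfl hne
  | @cons _ u _ hadj q =>
    have h1 := G.dist_le q
    have h2 := hadj.reachable.dist_triangle_left r
    rw [dist_eq_one_iff_adj.2 hadj] at h2
    rw [Walk.length_cons] at hp
    refine ⟨u, hadj, q.reverse.reachable, ?_⟩
    rw [G.dist_comm (u := r), G.dist_comm (u := r)]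
    omega

theorem IsTree.dist_adj_cases (hT : G.IsTree) (r : V) {u v : V} (h : G.Adj u v) :
    G.dist r v = G.dist r u + 1 ∨ G.dist r u = G.dist r v + 1 := by
  obtain ⟨p, hp, hpl⟩ := hT.connected.exists_path_of_dist r u
  by_cases hv : v ∈ p.support
  · right
    obtain ⟨q, hq, hql⟩ := hT.connected.exists_path_of_dist r v
    have := hT.isAcyclic.path_concat hq hp h.symm hv
    rw [← hpl, this, Walk.length_concat, hql]
  · left
    rw [← hT.length_eq_dist_of_isPath (hp.concat hv h), Walk.length_concat, hpl]

theorem IsTree.eq_of_adj_of_dist_eq (hT : G.IsTree) {r v u u' : V} (h : G.Adj v u)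
    (h' : G.Adj v u') (hd : G.dist r v = G.dist r u + 1) (hd' : G.dist r v = G.dist r u' + 1) :
    u = u' := by
  obtain ⟨p, hp, hpl⟩ := hT.connected.exists_path_of_dist r u
  obtain ⟨q, hq, hql⟩ := hT.connected.exists_path_of_dist r u'
  have key : ∀ {w : V} {p : G.Walk r w} (ha : G.Adj v w), p.length = G.dist r w →
      G.dist r v = G.dist r w + 1 → (p.concat ha.symm).IsPath := fun ha hl hd =>
    Walk.isPath_of_length_eq_dist _ (by rw [Walk.length_concat, hl, hd])
  have := (hT.existsUnique_path r v).unique (key h hpl hd) (key h' hql hd')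
  have h2 := congrArg Walk.penultimate this
  simpa using h2

theorem IsTree.exists_adj_dist_eq (hT : G.IsTree) {r v : V} (hne : r ≠ v) :
    ∃ u, G.Adj v u ∧ G.dist r v = G.dist r u + 1 := by
  obtain ⟨u, h, -, h'⟩ := (hT.connected r v).exists_adj_dist_eq hne
  exact ⟨u, h, h'⟩

theorem ComponentCompl.reachable {K : Set V} {C : G.ComponentCompl K} {a b : V} (ha : a ∈ C)
    (hb : b ∈ C) : (G.induce Kᶜ).Reachable ⟨a, ha.choose⟩ ⟨b, hb.choose⟩ :=
  ConnectedComponent.exact (ha.choose_spec.trans hb.choose_spec.symm)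

/-- A component of the complement of a set of vertices of a tree contains the parent of each of
its vertices other than the root, provided it contains the root. -/
theorem IsTree.mem_componentCompl_of_dist_eq (hT : G.IsTree) {K : Set V} {C : G.ComponentCompl K}
    {r u v : V} (hr : r ∈ C) (hv : v ∈ C) (h : G.Adj v u) (hd : G.dist r v = G.dist r u + 1) :
    u ∈ C := by
  have hreach := ComponentCompl.reachable hr hv
  have hne : r ≠ v := by
    rintro rfl
    simp at hd
  obtain ⟨w, hw, hrw, hdw⟩ := hreach.exists_adj_dist_eq (fun h => hne (congrArg Subtype.val h))
  rw [hT.dist_induce hreach, hT.dist_induce hrw] at hdw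
  rw [hT.eq_of_adj_of_dist_eq h hw hd hdw]
  exact ComponentCompl.mem_of_adj v w hv w.2 hw

theorem finite_neighbors [G.LocallyFinite] (v : V) : {w | G.Adj v w}.Finite :=
  (G.neighborSet v).toFinite

theorem IsRegularOfDegree.ncard_neighbors [G.LocallyFinite] {k : ℕ} (hk : G.IsRegularOfDegree k)
    (v : V) : {w | G.Adj v w}.ncard = k := by
  rw [← hk v, ← card_neighborFinset_eq_degree, ← Set.ncard_coe_finset, coe_neighborFinset]
  rfl

theorem finite_setOf_dist_le [G.LocallyFinite] (hG : G.Connected) (x : V) (n : ℕ) :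
    {y | G.dist x y ≤ n}.Finite := by
  induction n with
  | zero =>
    refine (Set.finite_singleton x).subset fun y hy => ?_
    exact ((hG.dist_eq_zero_iff).1 (Nat.le_zero.1 hy)).symm
  | succ n ih =>
    refine ((Set.finite_singleton x).union (ih.biUnion fun y _ => G.finite_neighbors y)).subset
      fun y hy => ?_
    by_cases hxy : x = y
    · exact Or.inl hxy.symm
    · obtain ⟨u, hu, -, hd⟩ := (hG x y).exists_adj_dist_eq hxy
      refine Or.inr (Set.mem_biUnion (x := u) ?_ hu.symm)
      have : G.dist x y ≤ n + 1 := hy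
      show G.dist x u ≤ n
      omega

theorem exists_adj_of_mem_of_notMem (hG : G.Connected) {S : Set V} {a b : V} (ha : a ∈ S)
    (hb : b ∉ S) : ∃ u v, G.Adj u v ∧ u ∈ S ∧ v ∉ S := by
  obtain ⟨p⟩ := hG a b
  obtain ⟨d, -, h1, h2⟩ := p.exists_boundary_dart S ha hb
  exact ⟨d.fst, d.snd, d.adj, h1, h2⟩

end SimpleGraph

/-! ### Maps of trees built star by star -/

namespace SimpleGraph

variable {V : Type*} {G : SimpleGraph V}

/-- Star-by-star construction of a map on a tree rooted at `r`: `S u a s` says that `s` is an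
admissible choice of values on the neighbors of `u` when `u` has the value `a`. -/
theorem IsTree.exists_map_of_star_extension {Y : Type*} (hT : G.IsTree) (r : V)
    (S : V → Y → (V → Y) → Prop)
    (hloc : ∀ u a s s', (∀ w, G.Adj u w → s w = s' w) → S u a s → S u a s')
    (y₀ : Y) (hroot : ∃ s, S r y₀ s)
    (hstep : ∀ u a s w, S u a s → G.Adj u w → G.dist r w = G.dist r u + 1 →
      ∃ s', S w (s w) s' ∧ s' u = a) :
    ∃ f : V → Y, f r = y₀ ∧ ∀ u, S u (f u) f := by
  obtain ⟨s₀, hs₀⟩ := hroot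
  have hpar : ∀ v, ∃ u, r ≠ v → G.Adj v u ∧ G.dist r v = G.dist r u + 1 := fun v => by
    by_cases h : r = v
    · exact ⟨v, fun h' => absurd h h'⟩
    · obtain ⟨u, hu⟩ := hT.exists_adj_dist_eq h
      exact ⟨u, fun _ => hu⟩
  choose par hpar using hpar
  have hnext : ∀ u a s w, ∃ s', S u a s → G.Adj u w → G.dist r w = G.dist r u + 1 →
      S w (s w) s' ∧ s' u = a := fun u a s w => by
    by_cases h : S u a s ∧ G.Adj u w ∧ G.dist r w = G.dist r u + 1
    · obtain ⟨s', hs'⟩ := hstep u a s w h.1 h.2.1 h.2.2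
      exact ⟨s', fun _ _ _ => hs'⟩
    · exact ⟨s, fun h1 h2 h3 => absurd ⟨h1, h2, h3⟩ h⟩
  choose next hnext using hnext
  -- Recursion on depth: the pair is the value at `v` and the choice of values on its star, both
  -- obtained from the pair at the parent. It is meaningful only at depth `G.dist r v`.
  let P : ℕ → V → Y × (V → Y) := fun n => Nat.rec (fun _ => (y₀, s₀))
    (fun _ Q v => ((Q (par v)).2 v, next (par v) (Q (par v)).1 (Q (par v)).2 v)) n
  let f : V → Y := fun v => (P (G.dist r v) v).1
  let g : V → V → Y := fun v => (P (G.dist r v) v).2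
  have hfr : f r = y₀ := by simp [f, P]
  have hgr : g r = s₀ := by simp [g, P]
  have hf : ∀ v, r ≠ v → f v = g (par v) v := fun v hv => by
    simp only [f, g, (hpar v hv).2, P]
  have hg : ∀ v, r ≠ v → g v = next (par v) (f (par v)) (g (par v)) v := fun v hv => by
    simp only [f, g, (hpar v hv).2, P]
  have key : ∀ n v, G.dist r v = n → S v (f v) (g v) ∧ (r ≠ v → g v (par v) = f (par v)) := by
    intro n
    induction n with
    | zero =>
      intro v hv
      obtain rfl := (hT.connected.dist_eq_zero_iff).1 hv
      exact ⟨by rw [hfr, hgr]; exact hs₀, fun h => absurd rfl h⟩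
    | succ n ih =>
      intro v hv
      have hne : r ≠ v := by
        rintro rfl
        simp at hv
      obtain ⟨h1, h2⟩ := hpar v hne
      have h3 := (ih (par v) (by omega)).1
      have h4 := hnext _ _ _ v h3 h1.symm h2
      rw [← hg v hne, ← hf v hne] at h4
      exact ⟨h4.1, fun _ => h4.2⟩
  refine ⟨f, hfr, fun u => hloc u _ (g u) _ (fun w hw => ?_) (key _ u rfl).1⟩
  rcases hT.dist_adj_cases r hw with h | h
  · have hne : r ≠ w := by
      rintro rfl
      simp at h
    rw [hf w hne, hT.eq_of_adj_of_dist_eq (hpar w hne).1 hw.symm (hpar w hne).2 h]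
  · have hne : r ≠ u := by
      rintro rfl
      simp at h
    have := (key _ u rfl).2 hne
    rwa [hT.eq_of_adj_of_dist_eq (hpar u hne).1 hw (hpar u hne).2 h] at this

/-- A map of a tree which is bijective on stars is bijective. -/
theorem IsTree.bijective_of_bijOn_neighbors (hT : G.IsTree) {f : V → V}
    (hf : ∀ u, Set.BijOn f {w | G.Adj u w} {w | G.Adj (f u) w}) : Function.Bijective f := by
  have := hT.connected.nonempty
  let x : V := Classical.arbitrary V
  have hadj : ∀ {u w}, G.Adj u w → G.Adj (f u) (f w) := fun h => (hf _).mapsTo h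
  have hne : ∀ {v n}, G.dist x v = n + 1 → x ≠ v := by
    rintro v n h rfl
    simp at h
  have hdist : ∀ n v, G.dist x v = n → G.dist (f x) (f v) = n := by
    intro n
    induction n using Nat.strong_induction_on with
    | _ n ih =>
      intro v hv
      cases n with
      | zero =>
        obtain rfl := (hT.connected.dist_eq_zero_iff).1 hv
        simp
      | succ n =>
        obtain ⟨u, hu, hd⟩ := hT.exists_adj_dist_eq (hne hv)
        have hn : G.dist x u = n := by omega
        have hfu := ih n (by omega) u hn
        rcases hT.dist_adj_cases (f x) (hadj hu.symm) with h | h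
        · omega
        -- If the image turned back at `f u`, then `v` and the parent `u'` of `u` would have the
        -- same image, against injectivity on the star of `u`.
        · exfalso
          obtain ⟨m, rfl⟩ : ∃ m, n = m + 1 := ⟨n - 1, by omega⟩
          obtain ⟨u', hu', hd'⟩ := hT.exists_adj_dist_eq (hne hn)
          have hfu' := ih m (by omega) u' (by omega)
          have := hT.eq_of_adj_of_dist_eq (hadj hu') (hadj hu.symm) (by omega) h
          have := (hf u).injOn hu' hu.symm this
          subst this
          omega
  constructor
  · have hinj : ∀ n v w, G.dist x v = n → f v = f w → v = w := by
      intro n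
      induction n with
      | zero =>
        intro v w hv hvw
        have h1 := hdist _ v hv
        have h2 := hdist _ w rfl
        rw [← hvw, h1] at h2
        rw [← (hT.connected.dist_eq_zero_iff).1 hv, (hT.connected.dist_eq_zero_iff).1 h2.symm]
      | succ n ih =>
        intro v w hv hvw
        have h1 := hdist _ v hv
        have h2 := hdist _ w rfl
        rw [← hvw, h1] at h2
        obtain ⟨u, hu, hd⟩ := hT.exists_adj_dist_eq (hne hv)
        obtain ⟨u', hu', hd'⟩ := hT.exists_adj_dist_eq (hne h2.symm)
        have h3 := hdist _ u rfl
        have h4 := hdist _ u' rfl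
        have h5 : f u = f u' := hT.eq_of_adj_of_dist_eq (r := f x) (hadj hu)
          (hvw ▸ hadj hu') (by omega) (by omega)
        have h6 := ih u u' (by omega) h5
        subst h6
        exact (hf u).injOn hu.symm hu'.symm hvw
    exact fun v w => hinj _ v w rfl
  · by_contra hsurj
    rw [← Set.range_eq_univ, Set.eq_univ_iff_forall] at hsurj
    push Not at hsurj
    obtain ⟨b, hb⟩ := hsurj
    obtain ⟨u, v, huv, ⟨u', rfl⟩, hv⟩ :=
      exists_adj_of_mem_of_notMem hT.connected (Set.mem_range_self x) hb
    obtain ⟨v', -, rfl⟩ := (hf u').surjOn huv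
    exact hv (Set.mem_range_self v')

end SimpleGraph

/-! ### Label-preserving bijections and automorphisms -/

theorem Set.exists_bijOn_comp_eq {V X : Type*} {A B : Set V} (hA : A.Finite) (hB : B.Finite)
    {π : V → X} (h : ∀ y, {w | w ∈ A ∧ π w = y}.ncard = {w | w ∈ B ∧ π w = y}.ncard) :
    ∃ s : V → V, Set.BijOn s A B ∧ ∀ w ∈ A, π (s w) = π w := by
  rcases isEmpty_or_nonempty V with hV | hV
  · exact ⟨id, by simp [Set.eq_empty_of_isEmpty], fun w => isEmptyElim w⟩
  have hA' : ∀ y, {w | w ∈ A ∧ π w = y}.Finite := fun y => hA.subset fun _ h => h.1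
  have hB' : ∀ y, {w | w ∈ B ∧ π w = y}.Finite := fun y => hB.subset fun _ h => h.1
  have := fun y => (hA' y).exists_bijOn_of_encard_eq (t := {w | w ∈ B ∧ π w = y}) (by
    rw [← (hA' y).cast_ncard_eq, ← (hB' y).cast_ncard_eq, h y])
  choose s hs using this
  have hsA : ∀ w ∈ A, s (π w) w ∈ B ∧ π (s (π w) w) = π w := fun w hw =>
    (hs (π w)).mapsTo ⟨hw, rfl⟩
  refine ⟨fun w => s (π w) w, ⟨fun w hw => (hsA w hw).1, ?_, ?_⟩, fun w hw => (hsA w hw).2⟩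
  · intro v hv w hw hvw
    dsimp only at hvw
    have hπ : π w = π v := by rw [← (hsA v hv).2, ← (hsA w hw).2, hvw]
    rw [hπ] at hvw
    exact (hs (π v)).injOn ⟨hv, rfl⟩ ⟨hw, hπ⟩ hvw
  · intro b hb
    obtain ⟨w, ⟨hw, hwb⟩, hwb'⟩ := (hs (π b)).surjOn ⟨hb, rfl⟩
    exact ⟨w, hw, by dsimp only; rw [hwb, hwb']⟩

/-- Composing with a transposition prescribes one value. In a star-by-star construction this is the
value at the parent, which is already fixed. -/
theorem Set.BijOn.exists_bijOn_comp_eq_of_mem {V X : Type*} {A B : Set V} {π : V → X} {s : V → V}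
    (hs : Set.BijOn s A B) (hπ : ∀ w ∈ A, π (s w) = π w) {p b : V} (hp : p ∈ A) (hb : b ∈ B)
    (hpb : π p = π b) :
    ∃ s' : V → V, (Set.BijOn s' A B ∧ ∀ w ∈ A, π (s' w) = π w) ∧ s' p = b := by
  classical
  have hsp := hs.mapsTo hp
  have hσ : Set.BijOn (Equiv.swap (s p) b) B B := by
    refine (Equiv.swap (s p) b).bijOn fun z => ?_
    rw [Equiv.swap_apply_def]
    split_ifs with h1 h2
    · simp [h1, hb, hsp]
    · simp [h2, hb, hsp]
    · rfl
  refine ⟨Equiv.swap (s p) b ∘ s, ⟨hσ.comp hs, fun w hw => ?_⟩, by simp⟩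
  rw [← hπ w hw, Function.comp_apply, Equiv.swap_apply_def]
  have := hπ p hp
  split_ifs with h1 h2
  · rw [h1, this, hpb]
  · rw [h2, this, hpb]
  · rfl

namespace SimpleGraph

variable {V : Type*} {G : SimpleGraph V}

/-- Equal counts give label-preserving bijections between the stars of equally labelled vertices.
Glued outward from `x`, they form a map bijective on stars, hence an automorphism. -/
theorem IsTree.exists_iso_of_ncard_eq [G.LocallyFinite] (hT : G.IsTree) {X : Type*} {π : V → X}
    (h : ∀ u a, π u = π a → ∀ y,
      {w | G.Adj u w ∧ π w = y}.ncard = {w | G.Adj a w ∧ π w = y}.ncard)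
    {x y : V} (hxy : π x = π y) : ∃ γ : G ≃g G, γ x = y ∧ ∀ v, π (γ v) = π v := by
  have hstar : ∀ u a, π u = π a → ∃ s : V → V, Set.BijOn s {w | G.Adj u w} {w | G.Adj a w} ∧
      ∀ w ∈ {w | G.Adj u w}, π (s w) = π w := fun u a hua =>
    Set.exists_bijOn_comp_eq (G.finite_neighbors u) (G.finite_neighbors a) (h u a hua)
  obtain ⟨f, hfx, hf⟩ := hT.exists_map_of_star_extension x
    (fun u a s => π u = π a ∧ Set.BijOn s {w | G.Adj u w} {w | G.Adj a w} ∧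
      ∀ w ∈ {w | G.Adj u w}, π (s w) = π w)
    (fun u a s s' hss' hs => ⟨hs.1, hs.2.1.congr hss', fun w hw => by
      rw [← hss' w hw]; exact hs.2.2 w hw⟩)
    y (by
      obtain ⟨s, hs⟩ := hstar x y hxy
      exact ⟨s, hxy, hs⟩)
    (fun u a s w hs huw _ => by
      have hπ := (hs.2.2 w huw).symm
      obtain ⟨t, ht⟩ := hstar w (s w) hπ
      obtain ⟨s', hs', hs'u⟩ := ht.1.exists_bijOn_comp_eq_of_mem ht.2 (p := u) (b := a)
        huw.symm (hs.2.1.mapsTo huw).symm hs.1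
      exact ⟨s', ⟨hπ, hs'⟩, hs'u⟩)
  have hbij := hT.bijective_of_bijOn_neighbors fun u => (hf u).2.1
  refine ⟨⟨Equiv.ofBijective f hbij, fun {a b} => ⟨fun hab => ?_, fun hab => ?_⟩⟩, hfx,
    fun v => (hf v).1.symm⟩
  · obtain ⟨b', hb', hbb'⟩ := (hf a).2.1.surjOn hab
    rwa [← hbij.injective hbb']
  · exact (hf a).2.1.mapsTo hab

end SimpleGraph

/-- The group of automorphisms preserving `π` is transitive on each fiber, so its orbits are at most
as many as the vertices of the finite graph. -/
theorem IsLiftFromFinite.isPeriodicColoring {V A : Type*} {G : SimpleGraph V} [G.LocallyFinite]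
    (hT : G.IsTree) {ψ : V → A} (h : IsLiftFromFinite G ψ) : IsPeriodicColoring G ψ := by
  obtain ⟨N, I, π, c, ⟨-, hπ⟩, rfl⟩ := h
  let Γ : Subgroup (G ≃g G) :=
    { carrier := {γ | ∀ v, π (γ v) = π v}
      mul_mem' := fun {a b} ha hb v => (ha (b v)).trans (hb v)
      one_mem' := fun v => rfl
      inv_mem' := fun {a} ha v => by
        have := ha (a⁻¹ v)
        rw [RelIso.apply_inv_self] at this
        exact this.symm }
  refine ⟨Γ, ?_, fun γ hγ x => congrArg c (hγ x)⟩
  refine Finite.of_injective (β := Fin N)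
    (Quotient.lift π (fun a b hab => ?_)) ?_
  · obtain ⟨γ, rfl⟩ := hab
    exact γ.2 b
  · rintro ⟨a⟩ ⟨b⟩ hab
    obtain ⟨γ, hγ, hγ'⟩ := hT.exists_iso_of_ncard_eq (π := π) (fun u a hua y => by
      rw [Set.ncard, Set.ncard, hπ, hπ, hua]) (x := b) (y := a) (Eq.symm hab)
    exact Quotient.sound ⟨⟨γ, hγ'⟩, hγ⟩

/-! ### Extending labellings and producing lifts -/

namespace SimpleGraph

variable {V : Type*} {G : SimpleGraph V}

/-- A labelling of a component `C` of the complement of a set, with `d a b` neighbors labelled `b`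
around each vertex of `C` labelled `a`, extends to a labelling of the whole tree. -/
theorem IsTree.exists_labelling_extension [G.LocallyFinite] (hT : G.IsTree) {k : ℕ}
    (hk : G.IsRegularOfDegree k) {L : Type*} {d : L → L → ℕ}
    (hd : ∀ a b, 0 < d a b → 0 < d b a) {ℓ : V → L} {K : Set V} (C : G.ComponentCompl K)
    (hC : ∀ v ∈ C, ∀ y, {w | G.Adj v w ∧ ℓ w = y}.ncard = d (ℓ v) y)
    (hmodel : ∀ a b, 0 < d a b → ∃ v, ∀ y, {w | G.Adj v w ∧ ℓ w = y}.ncard = d a y) :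
    ∃ π : V → L, Set.EqOn π ℓ C ∧ ∀ v y, {w | G.Adj v w ∧ π w = y}.ncard = d (π v) y := by
  obtain ⟨r, hr⟩ := C.nonempty
  -- All stars have `k` leaves, so the labels around a model vertex can be copied to the star of
  -- `u`, with a leaf labelled `b` going to `p`.
  have hstar : ∀ u a p b, G.Adj u p → 0 < d a b →
      ∃ s : V → L, (∀ y, {w | G.Adj u w ∧ s w = y}.ncard = d a y) ∧ s p = b := by
    intro u a p b hup hab
    obtain ⟨v, hv⟩ := hmodel a b hab
    obtain ⟨q, hvq, rfl⟩ : {w | G.Adj v w ∧ ℓ w = b}.Nonempty := by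
      refine Set.nonempty_of_ncard_ne_zero ?_
      rw [hv]
      exact hab.ne'
    obtain ⟨s, hs, -⟩ := Set.exists_bijOn_comp_eq (π := fun _ : V => ()) (G.finite_neighbors u)
      (G.finite_neighbors v) (fun y => by
        simpa using (hk.ncard_neighbors u).trans (hk.ncard_neighbors v).symm)
    obtain ⟨s', ⟨hs', -⟩, rfl⟩ := hs.exists_bijOn_comp_eq_of_mem (π := fun _ : V => ())
      (fun _ _ => rfl) (p := p) (b := q) hup hvq rfl
    refine ⟨ℓ ∘ s', fun y => ?_, rfl⟩
    rw [← hv y, ← (hs'.injOn.mono fun w hw => hw.1 :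
      Set.InjOn s' {w | G.Adj u w ∧ (ℓ ∘ s') w = y}).ncard_image]
    congr 1
    ext z
    constructor
    · rintro ⟨w, ⟨hw, hwy⟩, rfl⟩
      exact ⟨hs'.mapsTo hw, hwy⟩
    · rintro ⟨hz, hzy⟩
      obtain ⟨w, hw, rfl⟩ := hs'.surjOn hz
      exact ⟨w, ⟨hw, hzy⟩, rfl⟩
  obtain ⟨π, -, hπ⟩ := hT.exists_map_of_star_extension r
    (fun u a s => (u ∈ C → a = ℓ u ∧ ∀ w, G.Adj u w → s w = ℓ w) ∧
      ∀ y, {w | G.Adj u w ∧ s w = y}.ncard = d a y)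
    (fun u a s s' hss' hs => ⟨fun hu => ⟨(hs.1 hu).1, fun w hw => by
        rw [← hss' w hw, (hs.1 hu).2 w hw]⟩, fun y => by
        rw [← hs.2 y]
        congr 1
        ext w
        exact and_congr_right fun hw => by rw [hss' w hw]⟩)
    (ℓ r) ⟨ℓ, fun _ => ⟨rfl, fun _ _ => rfl⟩, hC r hr⟩
    (fun u a s w hs huw hdist => by
      by_cases hw : w ∈ C
      · have hu := hT.mem_componentCompl_of_dist_eq hr hw huw.symm hdist
        rw [(hs.1 hu).1, (hs.1 hu).2 w huw]
        exact ⟨ℓ, ⟨fun _ => ⟨rfl, fun _ _ => rfl⟩, hC w hw⟩, rfl⟩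
      -- Outside `C` the star at `w` must give its parent `u` the label `a`. The vertex `w` itself
      -- witnesses `0 < d a (s w)`, and the symmetry of positivity makes `a` available around `w`.
      · have hpos : 0 < d a (s w) := by
          rw [← hs.2]
          exact (Set.ncard_pos ((G.finite_neighbors u).subset fun _ h => h.1)).2 ⟨w, huw, rfl⟩
        obtain ⟨s', hs', hs'u⟩ := hstar w (s w) u a huw.symm (hd _ _ hpos)
        exact ⟨s', ⟨fun h => absurd h hw, hs'⟩, hs'u⟩)
  exact ⟨π, fun v hv => ((hπ v).1 hv).1, fun v => (hπ v).2⟩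

end SimpleGraph

theorem isLiftFromFinite_comp {V A L : Type*} {G : SimpleGraph V} [G.LocallyFinite] [Finite L]
    {d : L → L → ℕ} (hd : ∀ a b, 0 < d a b → 0 < d b a) {π : V → L}
    (hπ : ∀ v y, {w | G.Adj v w ∧ π w = y}.ncard = d (π v) y) (c : L → A) :
    IsLiftFromFinite G (c ∘ π) := by
  -- Restricting to the labels that occur makes the projection onto.
  obtain ⟨N, ⟨e⟩⟩ := Finite.exists_equiv_fin (Set.range π)
  refine ⟨N, ⟨fun x y => d (e.symm x) (e.symm y), fun x y => hd _ _⟩,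
    fun v => e ⟨π v, v, rfl⟩, fun x => c (e.symm x), ⟨fun x => ?_, fun v y => ?_⟩, ?_⟩
  · obtain ⟨⟨_, v, rfl⟩, rfl⟩ := e.surjective x
    exact ⟨v, rfl⟩
  · have hset : {w | G.Adj v w ∧ e ⟨π w, w, rfl⟩ = y} = {w | G.Adj v w ∧ π w = e.symm y} := by
      ext w
      refine and_congr_right fun _ => ?_
      rw [← Equiv.eq_symm_apply, Subtype.ext_iff]
    rw [hset, ← ((G.finite_neighbors v).subset fun _ h => h.1).cast_ncard_eq, hπ]
    simp
  · ext v
    simp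

/-! ### Isomorphisms of colored balls and subtrees -/

namespace SimpleGraph

variable {V : Type*} {G : SimpleGraph V}

theorem Iso.dist_eq {W : Type*} {H : SimpleGraph W} (f : G ≃g H) (hG : G.Connected) (u v : V) :
    H.dist (f u) (f v) = G.dist u v := by
  apply le_antisymm
  · obtain ⟨p, hp⟩ := hG.exists_walk_length_eq_dist u v
    rw [← hp, ← Walk.length_map f.toHom]
    exact H.dist_le _
  · obtain ⟨p, hp⟩ := (f.connected_iff.1 hG).exists_walk_length_eq_dist (f u) (f v)
    rw [← hp, ← Walk.length_map f.symm.toHom]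
    refine (G.dist_le ((p.map f.symm.toHom).copy ?_ ?_)).trans_eq (Walk.length_copy _ _ _)
    · exact f.symm_apply_apply u
    · exact f.symm_apply_apply v

theorem IsTree.dist_iso_induce (hT : G.IsTree) {K K' : Set V} (hK : (G.induce K).Connected)
    (f : G.induce K ≃g G.induce K') (u v : K) : G.dist (f u : V) (f v) = G.dist (u : V) v := by
  rw [← hT.dist_induce (hK u v), ← f.dist_eq hK, hT.dist_induce (f.connected_iff.1 hK _ _)]

theorem reachable_induce_mono {S T : Set V} (h : S ⊆ T) {a b : V} {ha : a ∈ S} {hb : b ∈ S}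
    (hab : (G.induce S).Reachable ⟨a, ha⟩ ⟨b, hb⟩) :
    (G.induce T).Reachable ⟨a, h ha⟩ ⟨b, h hb⟩ :=
  hab.map (induceHomOfLE G h).toHom

end SimpleGraph

open SimpleGraph

section

variable {V A : Type*} {G : SimpleGraph V} {φ : V → A}

theorem mem_nBall_self (n : ℕ) (x : V) : x ∈ nBall G n x := by
  simp [nBall]

theorem connected_induce_nBall (hG : G.Connected) (n : ℕ) (x : V) :
    (G.induce (nBall G n x)).Connected := by
  have key : ∀ j y, G.dist x y = j → ∀ hy : y ∈ nBall G n x,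
      (G.induce (nBall G n x)).Reachable ⟨x, mem_nBall_self n x⟩ ⟨y, hy⟩ := by
    intro j
    induction j with
    | zero =>
      intro y hj hy
      obtain rfl := (hG.dist_eq_zero_iff).1 hj
      exact Reachable.refl _
    | succ j ih =>
      intro y hj hy
      have hne : x ≠ y := by
        rintro rfl
        simp at hj
      obtain ⟨u, hu, -, hd⟩ := (hG x y).exists_adj_dist_eq hne
      have hu' : u ∈ nBall G n x := by
        have : G.dist x y ≤ n := hy
        show G.dist x u ≤ n
        omega
      have hadj : (G.induce (nBall G n x)).Adj ⟨u, hu'⟩ ⟨y, hy⟩ := hu.symm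
      exact (ih u (by omega) hu').trans hadj.reachable
  have : Nonempty (nBall G n x) := ⟨⟨x, mem_nBall_self n x⟩⟩
  exact ⟨fun a b => (key _ a rfl a.2).symm.trans (key _ b rfl b.2)⟩

theorem ColorEquiv.of_iso {K K' S S' : Set V} (f : G.induce K ≃g G.induce K')
    (hf : ∀ v : K, φ (f v) = φ v) (hS : S ⊆ K) (hS' : S' ⊆ K')
    (h : ∀ v : K, (v : V) ∈ S ↔ (f v : V) ∈ S') : ColorEquiv G φ S S' :=
  ⟨⟨{ toFun := fun v => ⟨f ⟨v, hS v.2⟩, (h ⟨v, hS v.2⟩).1 v.2⟩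
      invFun := fun v => ⟨f.symm ⟨v, hS' v.2⟩, (h _).2 (by simp)⟩
      left_inv := fun v => by simp
      right_inv := fun v => by simp },
    fun {a b} => f.map_rel_iff (a := ⟨a, hS a.2⟩) (b := ⟨b, hS b.2⟩)⟩,
    fun v => hf ⟨v, hS v.2⟩⟩

theorem ColorEquiv.nBall_of_iso (hT : G.IsTree) {K K' : Set V} (hK : (G.induce K).Connected)
    (f : G.induce K ≃g G.induce K') (hf : ∀ v : K, φ (f v) = φ v) {n : ℕ} {z : K}
    (hz : nBall G n z ⊆ K) (hz' : nBall G n (f z) ⊆ K') :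
    ColorEquiv G φ (nBall G n z) (nBall G n (f z)) :=
  .of_iso f hf hz hz' fun v => by
    show G.dist (z : V) v ≤ n ↔ G.dist (f z : V) (f v) ≤ n
    rw [hT.dist_iso_induce hK f]

theorem SimpleGraph.IsTree.exists_dist_eq_add (hT : G.IsTree)
    (hdeg : ∀ z p, ∃ w, G.Adj z w ∧ w ≠ p) (x y : V) (n : ℕ) :
    ∃ z, G.dist x z = n ∧ G.dist y z = n + G.dist y x := by
  induction n with
  | zero => exact ⟨x, by simp, by simp⟩
  | succ n ih =>
    obtain ⟨z, hxz, hyz⟩ := ih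
    obtain ⟨w, hw, hyw⟩ : ∃ w, G.Adj z w ∧ G.dist y w = G.dist y z + 1 := by
      by_cases hne : y = z
      · obtain ⟨w, hw, -⟩ := hdeg z z
        exact ⟨w, hw, by rw [hne, dist_self, dist_eq_one_iff_adj.2 hw]⟩
      · obtain ⟨p, hp, hd⟩ := hT.exists_adj_dist_eq hne
        obtain ⟨w, hw, hwp⟩ := hdeg z p
        refine ⟨w, hw, (hT.dist_adj_cases y hw).resolve_right fun h => ?_⟩
        exact hwp (hT.eq_of_adj_of_dist_eq hw hp h hd)
    refine ⟨w, ?_, by omega⟩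
    have h1 := hT.connected.dist_triangle (u := y) (v := x) (w := w)
    have h2 := hT.connected.dist_triangle (u := x) (v := z) (w := w)
    rw [dist_eq_one_iff_adj.2 hw] at h2
    omega

/-- If the image of `x` were not `y`, prolonging the path from it to `y` by `n` more steps would
reach a point of the ball at distance greater than `n` from that image, while all points of the
source are within `n` of `x`. -/
theorem iso_nBall_apply_center (hT : G.IsTree) (hdeg : ∀ z p, ∃ w, G.Adj z w ∧ w ≠ p) {n : ℕ}
    {x y : V} (f : G.induce (nBall G n x) ≃g G.induce (nBall G n y)) :
    (f ⟨x, mem_nBall_self n x⟩ : V) = y := by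
  obtain ⟨z, hyz, hz⟩ := hT.exists_dist_eq_add hdeg y (f ⟨x, mem_nBall_self n x⟩) n
  have h1 := hT.dist_iso_induce (connected_induce_nBall hT.connected n x) f
    ⟨x, mem_nBall_self n x⟩ (f.symm ⟨z, hyz.le⟩)
  rw [f.apply_symm_apply] at h1
  have h2 : G.dist x (f.symm ⟨z, hyz.le⟩) ≤ n := (f.symm ⟨z, hyz.le⟩).2
  dsimp only at h1
  exact (hT.connected.dist_eq_zero_iff).1 (by omega)

theorem nBall_subset_nBall (hG : G.Connected) {m n : ℕ} {x z : V} (h : G.dist x z + m ≤ n) :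
    nBall G m z ⊆ nBall G n x := fun w hw => by
  have h1 := hG.dist_triangle (u := x) (v := z) (w := w)
  have h2 : G.dist z w ≤ m := hw
  show G.dist x w ≤ n
  omega

theorem color_eq_of_ballSetoid (hT : G.IsTree) (hdeg : ∀ z p, ∃ w, G.Adj z w ∧ w ≠ p) {n : ℕ}
    {x y : V} (h : ballSetoid G φ n x y) : φ x = φ y := by
  obtain ⟨f, hf⟩ := h
  rw [← iso_nBall_apply_center hT hdeg f, hf]

theorem ballSetoid_of_succ (hT : G.IsTree) (hdeg : ∀ z p, ∃ w, G.Adj z w ∧ w ≠ p) {n : ℕ}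
    {x y : V} (h : ballSetoid G φ (n + 1) x y) : ballSetoid G φ n x y := by
  obtain ⟨f, hf⟩ := h
  have hc := iso_nBall_apply_center hT hdeg f
  have := ColorEquiv.nBall_of_iso hT (connected_induce_nBall hT.connected _ x) f hf (n := n)
    (z := ⟨x, mem_nBall_self _ x⟩) (nBall_subset_nBall hT.connected (by simp))
    (nBall_subset_nBall hT.connected (by simp [hc]))
  rwa [hc] at this

theorem exists_bijOn_neighbors_of_ballSetoid_succ (hT : G.IsTree)
    (hdeg : ∀ z p, ∃ w, G.Adj z w ∧ w ≠ p) {n : ℕ} {x y : V}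
    (h : ballSetoid G φ (n + 1) x y) : ∃ s : V → V,
      Set.BijOn s {w | G.Adj x w} {w | G.Adj y w} ∧ ∀ w, G.Adj x w → ballSetoid G φ n w (s w) := by
  classical
  obtain ⟨f, hf⟩ := h
  have hc := iso_nBall_apply_center hT hdeg f
  have hN : ∀ {x w}, G.Adj x w → w ∈ nBall G (n + 1) x := fun h => by
    show G.dist _ _ ≤ n + 1
    rw [dist_eq_one_iff_adj.2 h]
    omega
  let s : V → V := fun w => if h : w ∈ nBall G (n + 1) x then f ⟨w, h⟩ else w
  have hs : ∀ w (h : w ∈ nBall G (n + 1) x), s w = f ⟨w, h⟩ := fun w h => dif_pos h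
  have hadj : ∀ w (h : w ∈ nBall G (n + 1) x), G.Adj x w ↔ G.Adj y (f ⟨w, h⟩) := fun w h => by
    have := f.map_rel_iff (a := ⟨x, mem_nBall_self _ x⟩) (b := ⟨w, h⟩)
    rw [comap_adj, comap_adj] at this
    simp only [Function.Embedding.subtype_apply, hc] at this
    exact this.symm
  refine ⟨s, ⟨fun w hw => ?_, fun v hv w hw hvw => ?_, fun z hz => ?_⟩, fun w hw => ?_⟩
  · show G.Adj y (s w)
    rw [hs w (hN hw)]
    exact (hadj w (hN hw)).1 hw
  · rw [hs v (hN hv), hs w (hN hw)] at hvw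
    exact congrArg Subtype.val (f.injective (Subtype.ext hvw))
  · obtain ⟨⟨w, hw⟩, hfw⟩ := f.surjective ⟨z, hN hz⟩
    refine ⟨w, (hadj w hw).2 ?_, ?_⟩
    · rw [hfw]
      exact hz
    · rw [hs w hw, hfw]
  · rw [hs w (hN hw)]
    refine ColorEquiv.nBall_of_iso hT (connected_induce_nBall hT.connected _ x) f hf (n := n)
      (z := ⟨w, hN hw⟩) (nBall_subset_nBall hT.connected ?_) (nBall_subset_nBall hT.connected ?_)
    · rw [dist_eq_one_iff_adj.2 hw, add_comm]
    · rw [dist_eq_one_iff_adj.2 ((hadj w (hN hw)).1 hw), add_comm]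

theorem exists_subset_nBall (G : SimpleGraph V) {F : Set V} (hF : F.Finite) (x : V) :
    ∃ n, F ⊆ nBall G n x := by
  obtain ⟨n, hn⟩ := (hF.image (G.dist x)).bddAbove
  exact ⟨n, fun y hy => hn ⟨y, hy, rfl⟩⟩

theorem nBall_mono {m n : ℕ} (h : m ≤ n) (x : V) : nBall G m x ⊆ nBall G n x :=
  fun _ hy => le_trans hy h

theorem exists_finite_class_of_appearsExactlyOnce (hT : G.IsTree)
    (hdeg : ∀ z p, ∃ w, G.Adj z w ∧ w ≠ p) {K : Set V} (hK : IsFiniteSubtree G K)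
    (h : AppearsExactlyOnce G φ K) : ∃ n x, {y | ballSetoid G φ n x y}.Finite := by
  obtain ⟨x, hx⟩ := hK.2.nonempty
  obtain ⟨n, hn⟩ := exists_subset_nBall G hK.1 x
  refine ⟨n, x, hK.1.subset ?_⟩
  rintro y ⟨f, hf⟩
  -- The copy of `K` inside the ball around `y` is `K` itself, and it contains `y` as the image of
  -- `x`.
  have := h {z | ∃ v : nBall G n x, (v : V) ∈ K ∧ (f v : V) = z}
    (ColorEquiv.of_iso f hf hn (by rintro _ ⟨v, -, rfl⟩; exact (f v).2)
      fun v => ⟨fun hv => ⟨v, hv, rfl⟩, fun ⟨w, hw, hwv⟩ => by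
        rwa [f.injective (Subtype.ext hwv)] at hw⟩)
  rw [← this]
  exact ⟨⟨x, mem_nBall_self n x⟩, hx, iso_nBall_apply_center hT hdeg f⟩

/-- At a vertex whose `k` neighbors all lie in `K`, injectivity forces their images to be all `k`
neighbors of the image. The ball is filled outward in this way. -/
theorem nBall_subset_of_iso [G.LocallyFinite] {k : ℕ} (hT : G.IsTree)
    (hk : G.IsRegularOfDegree k) {K K' : Set V} (hK : (G.induce K).Connected)
    (f : G.induce K ≃g G.induce K') {n : ℕ} {y : K} (hy : nBall G n y ⊆ K) :
    nBall G n (f y) ⊆ K' := by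
  suffices key : ∀ j ≤ n, ∀ w, G.dist (f y : V) w = j → ∃ u : K, (f u : V) = w by
    intro w hw
    obtain ⟨u, rfl⟩ := key _ hw w rfl
    exact (f u).2
  intro j
  induction j with
  | zero =>
    intro _ w hw
    exact ⟨y, (hT.connected.dist_eq_zero_iff).1 hw⟩
  | succ j ih =>
    intro hj w hw
    have hne : (f y : V) ≠ w := by
      intro h
      simp [h] at hw
    obtain ⟨w₀, hw₀, hd⟩ := hT.exists_adj_dist_eq hne
    obtain ⟨u, rfl⟩ := ih (by omega) w₀ (by omega)
    have hyu : G.dist (y : V) u = j := by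
      rw [← hT.dist_iso_induce hK f]
      omega
    have hN : ∀ z, G.Adj u z → z ∈ K := fun z hz => hy <| by
      have := hT.connected.dist_triangle (u := (y : V)) (v := u) (w := z)
      rw [dist_eq_one_iff_adj.2 hz] at this
      show G.dist _ _ ≤ n
      omega
    have himg : (fun z : K => (f z : V)) '' {z : K | G.Adj (u : V) z} = {w | G.Adj (f u : V) w} := by
      refine Set.eq_of_subset_of_ncard_le ?_ ?_ (G.finite_neighbors _)
      · rintro _ ⟨z, hz, rfl⟩
        exact f.map_rel_iff.2 (show (G.induce K).Adj u z from hz)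
      · have hinj : Function.Injective fun z : K => (f z : V) :=
          Subtype.val_injective.comp f.injective
        rw [Set.ncard_image_of_injective _ hinj, hk.ncard_neighbors,
          ← hk.ncard_neighbors (u : V), ← Set.ncard_image_of_injective _ (Subtype.val_injective (p := (· ∈ K)))]
        refine Set.ncard_le_ncard (fun z hz => ⟨⟨z, hN z hz⟩, hz, rfl⟩)
          ((G.finite_neighbors (u : V)).subset ?_)
        rintro _ ⟨z, hz, rfl⟩
        exact hz
    obtain ⟨z, -, hz⟩ := himg.symm.subset (show w ∈ {w | G.Adj (f u : V) w} from hw₀.symm)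
    exact ⟨z, hz⟩

theorem exists_appearsExactlyOnce_of_finite_class [G.LocallyFinite] {k : ℕ} (hT : G.IsTree)
    (hk : G.IsRegularOfDegree k) {n : ℕ} {x : V} (hF : {y | ballSetoid G φ n x y}.Finite) :
    ∃ K : Set V, IsFiniteSubtree G K ∧ AppearsExactlyOnce G φ K := by
  set F := {y | ballSetoid G φ n x y} with hFdef
  obtain ⟨m, hm⟩ := exists_subset_nBall G hF x
  -- `M ≥ m` puts `x` in every ball of the union, making it connected; `M ≥ n` makes each ball show
  -- the class of its center.
  set M := max m n
  have hM : F ⊆ nBall G M x := hm.trans (nBall_mono (le_max_left _ _) x)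
  have hxF : x ∈ F := (ballSetoid G φ n).refl x
  set K : Set V := {v | ∃ y ∈ F, v ∈ nBall G M y} with hKdef
  have hball : ∀ y ∈ F, nBall G M y ⊆ K := fun y hy v hv => ⟨y, hy, hv⟩
  have hKfin : K.Finite := (hF.biUnion fun y _ => finite_setOf_dist_le hT.connected y M).subset <| by
    rintro v ⟨y, hy, hv⟩
    exact Set.mem_biUnion hy hv
  have hxK : x ∈ K := ⟨x, hxF, mem_nBall_self M x⟩
  have hKconn : (G.induce K).Connected := by
    have hreach : ∀ v : K, (G.induce K).Reachable ⟨x, hxK⟩ v := by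
      rintro ⟨v, y, hy, hv⟩
      have hx : x ∈ nBall G M y := by
        show G.dist y x ≤ M
        rw [G.dist_comm]
        exact hM hy
      exact reachable_induce_mono (hball y hy)
        (connected_induce_nBall hT.connected M y ⟨x, hx⟩ ⟨v, hv⟩)
    have : Nonempty K := ⟨⟨x, hxK⟩⟩
    exact ⟨fun a b => (hreach a).symm.trans (hreach b)⟩
  refine ⟨K, ⟨hKfin, hKconn⟩, ?_⟩
  rintro K' ⟨f, hf⟩
  -- An isomorphism sends centers in `F` to vertices of the same class, so again into `F`, and
  -- preserves distances. Hence `K' ⊆ K`, with equal cardinality.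
  refine Set.eq_of_subset_of_ncard_le ?_ ?_ hKfin
  · intro w hw
    obtain ⟨⟨v, y, hy, hv⟩, hvw⟩ := f.surjective ⟨w, hw⟩
    have hyK : y ∈ K := ⟨y, hy, mem_nBall_self M y⟩
    have hsub : nBall G n y ⊆ K := (nBall_mono (le_max_right _ _) y).trans (hball y hy)
    refine ⟨f ⟨y, hyK⟩, ?_, ?_⟩
    · exact (ballSetoid G φ n).trans hy (ColorEquiv.nBall_of_iso hT hKconn f hf (n := n)
        (z := ⟨y, hyK⟩) hsub (nBall_subset_of_iso hT hk hKconn f (y := ⟨y, hyK⟩) hsub))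
    · have := hT.dist_iso_induce hKconn f ⟨y, hyK⟩ ⟨v, y, hy, hv⟩
      rw [hvw] at this
      exact this.trans_le hv
  · exact (Nat.card_congr f.toEquiv).le

end

/-! ### Eventual periodicity forces a finite class -/

open SimpleGraph

section

variable {V A : Type*} {G : SimpleGraph V} {φ : V → A}

/-- The class of the colored `n`-ball around `x`. -/
def ballClass (G : SimpleGraph V) (φ : V → A) (n : ℕ) (x : V) : ColoredBall G φ n :=
  Quotient.mk (ballSetoid G φ n) x

theorem ballClass_eq_iff {n : ℕ} {x y : V} :
    ballClass G φ n x = ballClass G φ n y ↔ ballSetoid G φ n x y :=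
  Quotient.eq

theorem exists_ballClass_eq {n : ℕ} (q : ColoredBall G φ n) : ∃ x, ballClass G φ n x = q :=
  Quotient.exists_rep q

theorem IsSturmian.finite_coloredBall (hφ : IsSturmian G φ) (n : ℕ) :
    Finite (ColoredBall G φ n) := by
  have h : ENat.card (ColoredBall G φ n) = ((n + 2 : ℕ) : ℕ∞) := hφ n
  rw [← not_infinite_iff_finite]
  intro hinf
  rw [ENat.card_eq_top_of_infinite] at h
  exact ENat.natCast_ne_top _ h.symm

theorem IsSturmian.card_coloredBall (hφ : IsSturmian G φ) (n : ℕ) :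
    Nat.card (ColoredBall G φ n) = n + 2 := by
  have h : ENat.card (ColoredBall G φ n) = ((n + 2 : ℕ) : ℕ∞) := hφ n
  have := hφ.finite_coloredBall n
  rw [ENat.card_eq_coe_natCard] at h
  exact_mod_cast h

theorem IsSturmian.infinite (hφ : IsSturmian G φ) : Infinite V := by
  rw [← not_finite_iff_infinite]
  intro hfin
  have h := Nat.card_le_card_of_surjective (ballClass G φ (Nat.card V)) exists_ballClass_eq
  rw [hφ.card_coloredBall] at h
  omega

theorem SimpleGraph.IsRegularOfDegree.exists_adj_ne [G.LocallyFinite] [Infinite V] {k : ℕ}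
    (hk : G.IsRegularOfDegree k) (hG : G.Connected) (z p : V) : ∃ w, G.Adj z w ∧ w ≠ p := by
  by_cases h2 : 1 < k
  · rw [← hk.ncard_neighbors z] at h2
    exact Set.exists_ne_of_one_lt_ncard h2 p
  · exfalso
    obtain ⟨b, hb⟩ := ((G.finite_neighbors z).insert z).exists_notMem
    obtain ⟨u, v, huv, hu, hv⟩ := exists_adj_of_mem_of_notMem hG (Set.mem_insert z _) hb
    rcases hu with rfl | hu
    · exact hv (Or.inr huv)
    · refine hv (Or.inl ?_)
      exact (Set.ncard_le_one_iff (G.finite_neighbors u)).1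
        ((hk.ncard_neighbors u).trans_le (not_lt.1 h2)) huv hu.symm

theorem ColorEquiv.nBall_of_automorphism (hG : G.Connected) (γ : G ≃g G) {n : ℕ} {x : V}
    (h : ∀ v ∈ nBall G n x, φ (γ v) = φ v) :
    ColorEquiv G φ (nBall G n x) (nBall G n (γ x)) :=
  ⟨⟨γ.toEquiv.subtypeEquiv fun v => by
      show G.dist x v ≤ n ↔ G.dist (γ x) (γ v) ≤ n
      rw [γ.dist_eq hG], γ.map_rel_iff⟩, fun v => h v v.2⟩

theorem nBall_subset_componentCompl (hG : G.Connected) {K : Set V} {n : ℕ} {x : V}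
    (h : ∀ v ∈ nBall G n x, v ∉ K) :
    nBall G n x ⊆ (G.componentComplMk (h x (mem_nBall_self n x)) : Set V) := fun v hv =>
  ⟨h v hv, ConnectedComponent.sound (reachable_induce_mono (S := nBall G n x) h
    (connected_induce_nBall hG n x ⟨v, hv⟩ ⟨x, mem_nBall_self n x⟩))⟩

theorem exists_finite_class_of_isEventuallyPeriodic [G.LocallyFinite] (hT : G.IsTree)
    (hφ : IsSturmian G φ) (h : IsEventuallyPeriodic G φ) :
    ∃ n x, {y | ballSetoid G φ n x y}.Finite := by
  by_contra! hinf
  obtain ⟨K, ⟨hKfin, -⟩, hK⟩ := h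
  lift K to Finset V using hKfin
  have : Fact G.Preconnected := ⟨hT.connected.preconnected⟩
  choose ψ hψ hψφ using hK
  choose Γ hΓfin hΓ using hψ
  -- The `n + 2` classes will inject into this set of size `n`. Recording an orbit for every
  -- component avoids a dependent pair; only the orbit for the component containing the ball is
  -- used.
  set n := Nat.card (G.ComponentCompl (K : Set V) × ∀ C, MulAction.orbitRel.Quotient (Γ C) V)
    with hn
  have hrep : ∀ q : ColoredBall G φ n, ∃ x, ballClass G φ n x = q ∧
      ∀ v ∈ nBall G n x, v ∉ (K : Set V) := by
    intro q
    obtain ⟨x, rfl⟩ := exists_ballClass_eq q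
    obtain ⟨y, hy, hyK⟩ := ((hinf n x).sdiff (K.finite_toSet.biUnion fun z _ =>
      finite_setOf_dist_le hT.connected z n)).nonempty
    refine ⟨y, (ballClass_eq_iff.2 hy).symm, fun v hv hvK => hyK (Set.mem_biUnion hvK ?_)⟩
    show G.dist v y ≤ n
    rw [G.dist_comm]
    exact hv
  choose x hx hxK using hrep
  have hinj : Function.Injective fun q : ColoredBall G φ n =>
      ((G.componentComplMk (hxK q (x q) (mem_nBall_self n _)), fun C => Quotient.mk _ (x q)) :
        G.ComponentCompl (K : Set V) × ∀ C, MulAction.orbitRel.Quotient (Γ C) V) := by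
    intro q q' hqq'
    obtain ⟨hC, hO⟩ := Prod.ext_iff.1 hqq'
    dsimp only at hC hO
    have hb := nBall_subset_componentCompl hT.connected (hxK q)
    have hb' := nBall_subset_componentCompl hT.connected (hxK q')
    rw [← hC] at hb'
    generalize G.componentComplMk (hxK q (x q) (mem_nBall_self n _)) = C at hb hb'
    obtain ⟨γ, hγ⟩ := Quotient.exact (congrFun hO C)
    have hγ' : (γ : G ≃g G) (x q') = x q := hγ
    rw [← hx q, ← hx q', eq_comm, ballClass_eq_iff, ← hγ']
    refine ColorEquiv.nBall_of_automorphism hT.connected _ fun v hv => ?_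
    rw [← hψφ C (hb' hv), ← hψφ C (hb ?_)]
    · exact hΓ C _ γ.2 v
    · show G.dist _ _ ≤ n
      rw [← hγ', Iso.dist_eq _ hT.connected]
      exact hv
  have := Nat.card_le_card_of_injective _ hinj
  rw [hφ.card_coloredBall, ← hn] at this
  omega

/-! ### Finite classes and the unique splitting class -/

theorem ncard_neighbors_eq_of_ballSetoid_succ (hT : G.IsTree)
    (hdeg : ∀ z p, ∃ w, G.Adj z w ∧ w ≠ p) {n : ℕ} {x y : V} (h : ballSetoid G φ (n + 1) x y)
    (b : ColoredBall G φ n) : {w | G.Adj x w ∧ ballClass G φ n w = b}.ncard =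
      {w | G.Adj y w ∧ ballClass G φ n w = b}.ncard := by
  obtain ⟨s, hs, hsr⟩ := exists_bijOn_neighbors_of_ballSetoid_succ hT hdeg h
  rw [← (hs.injOn.mono fun w hw => hw.1 :
    Set.InjOn s {w | G.Adj x w ∧ ballClass G φ n w = b}).ncard_image]
  congr 1
  ext z
  constructor
  · rintro ⟨w, ⟨hw, hwb⟩, rfl⟩
    exact ⟨hs.mapsTo hw, by rw [← hwb, ballClass_eq_iff.2 (hsr w hw)]⟩
  · rintro ⟨hz, hzb⟩
    obtain ⟨w, hw, rfl⟩ := hs.surjOn hz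
    exact ⟨w, ⟨hw, by rw [← hzb, ballClass_eq_iff.2 (hsr w hw)]⟩, rfl⟩

/-- The vertices whose colored `n`-ball appears around finitely many vertices only. -/
def finiteClassSet (G : SimpleGraph V) (φ : V → A) (n : ℕ) : Set V :=
  {x | {y | ballSetoid G φ n x y}.Finite}

theorem finite_finiteClassSet (hφ : IsSturmian G φ) (n : ℕ) : (finiteClassSet G φ n).Finite := by
  have := hφ.finite_coloredBall n
  refine (Set.finite_iUnion
    (f := fun q : {q : ColoredBall G φ n // {y | ballClass G φ n y = q}.Finite} =>
      {y | ballClass G φ n y = q}) fun q => q.2).subset fun x hx => ?_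
  refine Set.mem_iUnion.2 ⟨⟨ballClass G φ n x, hx.subset fun y hy => ?_⟩, rfl⟩
  exact ballClass_eq_iff.1 (Eq.symm hy)

theorem mem_finiteClassSet_congr {n : ℕ} {x y : V} (h : ballSetoid G φ n x y)
    (hx : x ∈ finiteClassSet G φ n) : y ∈ finiteClassSet G φ n :=
  hx.subset fun _ hz => (ballSetoid G φ n).trans h hz

theorem finiteClassSet_subset_succ (hT : G.IsTree) (hdeg : ∀ z p, ∃ w, G.Adj z w ∧ w ≠ p) (n : ℕ) :
    finiteClassSet G φ n ⊆ finiteClassSet G φ (n + 1) := fun _ hx =>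
  hx.subset fun _ hy => ballSetoid_of_succ hT hdeg hy

/-- The `(n + 1)`-ball around `y` contains the `n`-ball around `x`, so any recurrence of it is
centered next to one of the finitely many vertices in the class of `x`. -/
theorem mem_finiteClassSet_succ_of_adj [G.LocallyFinite] (hT : G.IsTree)
    (hdeg : ∀ z p, ∃ w, G.Adj z w ∧ w ≠ p) {n : ℕ} {x y : V} (hx : x ∈ finiteClassSet G φ n)
    (hxy : G.Adj x y) : y ∈ finiteClassSet G φ (n + 1) := by
  refine (Set.Finite.biUnion hx fun z _ => G.finite_neighbors z).subset fun y' hy' => ?_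
  obtain ⟨s, hs, hsr⟩ := exists_bijOn_neighbors_of_ballSetoid_succ hT hdeg hy'
  exact Set.mem_biUnion (hsr x hxy.symm) (hs.mapsTo hxy.symm).symm

theorem exists_ballSetoid_notMem {n : ℕ} {x : V} (hx : x ∉ finiteClassSet G φ n) {S : Set V}
    (hS : S.Finite) : ∃ y, ballSetoid G φ n x y ∧ y ∉ S :=
  (Set.Infinite.sdiff hx hS).nonempty

/-- Once a class of colored balls is finite, the only class that splits is an infinite class that
loses a finite class. -/
theorem ballSetoid_succ_of_notMem [G.LocallyFinite] (hT : G.IsTree)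
    (hdeg : ∀ z p, ∃ w, G.Adj z w ∧ w ≠ p) (hφ : IsSturmian G φ) {n : ℕ}
    (hne : (finiteClassSet G φ n).Nonempty) {x y : V} (hx : x ∉ finiteClassSet G φ (n + 1))
    (hy : y ∉ finiteClassSet G φ (n + 1)) (hxy : ballSetoid G φ n x y) :
    ballSetoid G φ (n + 1) x y := by
  have := hφ.infinite
  have := hφ.finite_coloredBall n
  have := hφ.finite_coloredBall (n + 1)
  by_contra hxy'
  obtain ⟨a, ha⟩ := hne
  obtain ⟨b, hb⟩ := (finite_finiteClassSet hφ n).exists_notMem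
  obtain ⟨u, z, huz, hu, hz⟩ := exists_adj_of_mem_of_notMem hT.connected ha hb
  have hz' : z ∈ finiteClassSet G φ (n + 1) := mem_finiteClassSet_succ_of_adj hT hdeg hu huz
  -- The infinite `n`-class of `z` splits: it contains `z`, whose `(n + 1)`-class is finite, and
  -- `z'`, whose `(n + 1)`-class is infinite.
  obtain ⟨z', hzz', hz'n⟩ := exists_ballSetoid_notMem hz (finite_finiteClassSet hφ (n + 1))
  have hne1 : ∀ {v}, v ∉ finiteClassSet G φ (n + 1) →
      ballClass G φ (n + 1) v ≠ ballClass G φ (n + 1) z := fun hv h =>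
    hv (mem_finiteClassSet_congr (ballClass_eq_iff.1 h.symm) hz')
  let p : ColoredBall G φ (n + 1) → ColoredBall G φ n :=
    Quotient.map id fun _ _ h => ballSetoid_of_succ hT hdeg h
  have hp : ∀ v, p (ballClass G φ (n + 1) v) = ballClass G φ n v := fun _ => rfl
  -- With the classes of `z` and `x` removed, `n + 1` classes remain. They still map onto all `n +
  -- 2` of the `n`-classes, since `y` replaces `x`, and `z'` (or `y`, if `z'` has the class of `x`)
  -- replaces `z`.
  set S : Set (ColoredBall G φ (n + 1)) := {ballClass G φ (n + 1) z, ballClass G φ (n + 1) x}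
  have hyS : ballClass G φ (n + 1) y ∉ S := by
    rintro (h | h)
    · exact hne1 hy h
    · exact hxy' (ballClass_eq_iff.1 h.symm)
  have hpy : ballClass G φ n x ∈ p '' Sᶜ :=
    ⟨_, hyS, by rw [hp, ballClass_eq_iff.2 hxy]⟩
  have hpz : ballClass G φ n z ∈ p '' Sᶜ := by
    by_cases h : ballClass G φ (n + 1) z' = ballClass G φ (n + 1) x
    · rw [ballClass_eq_iff.2 hzz', ← hp, h]
      exact hpy
    · refine ⟨ballClass G φ (n + 1) z', ?_, by rw [hp, ballClass_eq_iff.2 hzz']⟩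
      rintro (h' | h')
      · exact hne1 hz'n h'
      · exact h h'
  have himg : p '' Sᶜ = Set.univ := by
    refine Set.eq_univ_of_forall fun q => ?_
    obtain ⟨v, rfl⟩ := exists_ballClass_eq q
    by_cases hv : ballClass G φ (n + 1) v ∈ S
    · rcases hv with h | h
      · rw [← hp, h]
        exact hpz
      · rw [← hp, h]
        exact hpy
    · exact ⟨_, hv, rfl⟩
  have h1 := Set.ncard_image_le (f := p) (Set.toFinite Sᶜ)
  have h2 := Set.ncard_add_ncard_compl S
  rw [Set.ncard_pair (hne1 hx).symm, hφ.card_coloredBall] at h2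
  rw [himg, Set.ncard_univ, hφ.card_coloredBall] at h1
  omega

theorem exists_isLiftFromFinite_of_finite_class [G.LocallyFinite] {k : ℕ} (hT : G.IsTree)
    (hk : G.IsRegularOfDegree k) (hφ : IsSturmian G φ) {n : ℕ} {x : V}
    (hx : {y | ballSetoid G φ n x y}.Finite) :
    ∃ K : Set V, IsFiniteSubtree G K ∧
      ∀ C : G.ComponentCompl K, ∃ ψ : V → A, Set.EqOn ψ φ C ∧ IsLiftFromFinite G ψ := by
  classical
  have := hφ.infinite
  have := hφ.finite_coloredBall n
  have hdeg := hk.exists_adj_ne hT.connected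
  have hne : (finiteClassSet G φ n).Nonempty := ⟨x, hx⟩
  obtain ⟨R, hR⟩ := exists_subset_nBall G (finite_finiteClassSet hφ (n + 1)) x
  refine ⟨nBall G R x, ⟨finite_setOf_dist_le hT.connected x R,
    connected_induce_nBall hT.connected R x⟩, fun C => ?_⟩
  -- The indices are read off a vertex outside `F_{n+1}`; one exists unless `a` is a finite class,
  -- and then the row is zero.
  let d : ColoredBall G φ n → ColoredBall G φ n → ℕ := fun a b =>
    if h : ∃ v, ballClass G φ n v = a ∧ v ∉ finiteClassSet G φ (n + 1) then
      {w | G.Adj h.choose w ∧ ballClass G φ n w = b}.ncard else 0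
  have hcount : ∀ v ∉ finiteClassSet G φ (n + 1), ∀ b,
      {w | G.Adj v w ∧ ballClass G φ n w = b}.ncard = d (ballClass G φ n v) b := by
    intro v hv b
    have h : ∃ v', ballClass G φ n v' = ballClass G φ n v ∧ v' ∉ finiteClassSet G φ (n + 1) :=
      ⟨v, rfl, hv⟩
    simp only [d, dif_pos h]
    exact ncard_neighbors_eq_of_ballSetoid_succ hT hdeg (ballSetoid_succ_of_notMem hT hdeg hφ hne
      hv h.choose_spec.2 (ballClass_eq_iff.1 h.choose_spec.1.symm)) b
  have hpos : ∀ v b, 0 < {w | G.Adj v w ∧ ballClass G φ n w = b}.ncard ↔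
      ∃ w, G.Adj v w ∧ ballClass G φ n w = b := fun v b =>
    Set.ncard_pos ((G.finite_neighbors v).subset fun _ h => h.1)
  have hd_rep : ∀ a b, 0 < d a b →
      ∃ v, ballClass G φ n v = a ∧ v ∉ finiteClassSet G φ (n + 1) := fun a b hab => by
    by_contra h
    simp [d, dif_neg h] at hab
  have hd : ∀ a b, 0 < d a b → 0 < d b a := by
    intro a b hab
    obtain ⟨v, rfl, hv⟩ := hd_rep a b hab
    -- Avoiding `F_{n+2}` keeps all neighbors of `v'` outside `F_{n+1}`, so the neighbor `w` can be
    -- used to compute `d b a`.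
    obtain ⟨v', hvv', hv'⟩ := exists_ballSetoid_notMem
      (fun h => hv (finiteClassSet_subset_succ hT hdeg n h)) (finite_finiteClassSet hφ (n + 2))
    rw [ballClass_eq_iff.2 hvv',
      ← hcount v' (fun h => hv' (finiteClassSet_subset_succ hT hdeg _ h)), hpos] at hab
    obtain ⟨w, hw, rfl⟩ := hab
    rw [← hcount w fun h => hv' (mem_finiteClassSet_succ_of_adj hT hdeg h hw.symm), hpos]
    exact ⟨v', hw.symm, (ballClass_eq_iff.2 hvv').symm⟩
  obtain ⟨π, hπC, hπ⟩ := hT.exists_labelling_extension hk hd (ℓ := ballClass G φ n) C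
    (fun v hv => hcount v fun h => ComponentCompl.notMem_of_mem hv (hR h))
    (fun a b hab => by
      obtain ⟨v, rfl, hv⟩ := hd_rep a b hab
      exact ⟨v, hcount v hv⟩)
  let c : ColoredBall G φ n → A :=
    Quotient.lift φ fun _ _ h => color_eq_of_ballSetoid hT hdeg h
  exact ⟨c ∘ π, fun v hv => congrArg c (hπC hv), isLiftFromFinite_comp hd hπ c⟩

end

theorem mainTheorem6 {V A : Type*} (G : SimpleGraph V) [G.LocallyFinite] (k : ℕ)
    (hT : G.IsTree) (hk : G.IsRegularOfDegree k) (φ : V → A) (hφ : IsSturmian G φ) :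
    (IsEventuallyPeriodic G φ ↔ ∃ K : Set V, IsFiniteSubtree G K ∧ AppearsExactlyOnce G φ K) ∧
    ((∃ K : Set V, IsFiniteSubtree G K ∧ AppearsExactlyOnce G φ K) →
      ∃ K : Set V, IsFiniteSubtree G K ∧
        ∀ C : G.ComponentCompl K, ∃ ψ : V → A,
          IsPeriodicColoring G ψ ∧ Set.EqOn ψ φ C ∧ IsLiftFromFinite G ψ) := by
  have main : (∃ K : Set V, IsFiniteSubtree G K ∧ AppearsExactlyOnce G φ K) →
      ∃ K : Set V, IsFiniteSubtree G K ∧ ∀ C : G.ComponentCompl K, ∃ ψ : V → A,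
        IsPeriodicColoring G ψ ∧ Set.EqOn ψ φ C ∧ IsLiftFromFinite G ψ := by
    rintro ⟨K, hK, hKφ⟩
    have := hφ.infinite
    obtain ⟨n, x, hx⟩ := exists_finite_class_of_appearsExactlyOnce hT
      (hk.exists_adj_ne hT.connected) hK hKφ
    obtain ⟨K', hK', h⟩ := exists_isLiftFromFinite_of_finite_class hT hk hφ hx
    refine ⟨K', hK', fun C => ?_⟩
    obtain ⟨ψ, hψ, hlift⟩ := h C
    exact ⟨ψ, hlift.isPeriodicColoring hT, hψ, hlift⟩
  refine ⟨⟨fun h => ?_, fun h => ?_⟩, main⟩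
  · obtain ⟨n, x, hx⟩ := exists_finite_class_of_isEventuallyPeriodic hT hφ h
    exact exists_appearsExactlyOnce_of_finite_class hT hk hx
  · obtain ⟨K, hK, h⟩ := main h
    refine ⟨K, hK, fun C => ?_⟩
    obtain ⟨ψ, hper, hψ, -⟩ := h C
    exact ⟨ψ, hper, hψ⟩
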